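/- Let $\mathbb{T}=\mathbb{R}/\mathbb{Z}$ be the circle (that is, $[0,1)$ with endpoints identified), with its usual metric, and let $\alpha\in(1,\infty]$. Let $\mathcal{E}^{\alpha}$ be the set of all $C^\alpha$ expanding Markov maps of the circle: local homeomorphisms $f:\mathbb{T}\to\mathbb{T}$ of class $C^\alpha$ for which there is $\gamma>1$ with $|f'(x)|>\gamma$ for all $x$, and for which finitely many points cut $\mathbb{T}$ into open arcs each of which $f$ maps bijectively onto $\mathbb{T}$ minus one point. For $\alpha=k+\beta<\infty$ with $k\in\mathbb{N}$ and $0\le\beta<1$, the space $\mathcal{E}^\alpha$ carries the distance $\|f-g\|_{C^\alpha}$ given by the uniform distance of the values and of the derivatives of order $1,\dots,k$, plus (if $\beta>0$) the $\beta$-Hölder seminorm of $f^{(k)}-g^{(k)}$; for $\alpha=\infty$ it carries the topology generated by all the $C^k$ distances, $k\in\mathbb{N}$. Let $\varphi\in\mathcal{E}^\alpha$, for example the doubling map $D(x)=2x \bmod 1$ (coded by the partition $\{[0,\frac12],[\frac12,1]\}$). A Markov partition of $\varphi$ is a finite cover $P_1,\dots,P_d$ of $\mathbb{T}$ by closed arcs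 with pairwise disjoint interiors such that $\varphi$ is injective on each $\operatorname{int}P_i$, and $\varphi(\operatorname{int}P_i)\supseteq\operatorname{int}P_j$ whenever $\varphi(\operatorname{int}P_i)$ meets $\operatorname{int}P_j$. A sequence $\underline{s}=(s_0,s_1,\dots)\in\{1,\dots,d\}^{\mathbb{N}}$ codes the point $x$ if $x\in\overline{\bigcap_{j<n}\varphi^{-j}(\operatorname{int}P_{s_j})}$ for every $n$. A set $K\subset\mathbb{T}$ is a subshift of finite type (SFT) of $\varphi$ if, for some Markov partition of $\varphi$ and some finite set $W$ of words, $K$ is the set of all points coded by the sequences in which no word of $W$ occurs. Then for $C^\alpha$-generic $f\in\mathcal{E}^\alpha$, i.e. for all $f$ in some dense $G_\delta$ subset of $\mathcal{E}^\alpha$, every subshift of finite type $K$ of $\varphi$ with Hausdorff dimension $\dim_H K<\frac12$ satisfies $$f(K)\cap K=\varnothing .$$ -/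

import Mathlib

open scoped ENNReal NNReal

noncomputable section

namespace ExpandingCircle

/-- The circle `ℝ / ℤ`, that is `[0, 1)` with endpoints identified, with its arc-length metric. -/
abbrev Circ : Type := UnitAddCircle

/-- `F : ℝ → ℝ` is a lift of the circle map `f`. -/
def IsLift (F : ℝ → ℝ) (f : Circ → Circ) : Prop :=
  Continuous F ∧ ∀ x : ℝ, ((F x : ℝ) : Circ) = f (x : Circ)

open Classical in
/-- A lift of `f` when there is one (every continuous `f` has one), and `0` otherwise. -/
def lift (f : Circ → Circ) : ℝ → ℝ :=
  if h : ∃ F, IsLift F f then h.choose else 0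

/-- The `j`-th derivative (`1 ≤ j`) of the circle map `f`, as a `1`-periodic real function.
By `circleDeriv_eq` below it does not depend on the lift. -/
def circleDeriv (j : ℕ) (f : Circ → Circ) : ℝ → ℝ :=
  iteratedDeriv j (lift f)

/-- Two lifts of the same map differ by a constant. -/
theorem IsLift.sub_const {F G : ℝ → ℝ} {f : Circ → Circ} (hF : IsLift F f) (hG : IsLift G f) :
    ∃ c : ℝ, F = fun x => G x + c := by
  have hint : ∀ x, ∃ n : ℤ, (n : ℝ) = F x - G x := by
    intro x
    have h : ((F x - G x : ℝ) : Circ) = 0 := by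
      rw [AddCircle.coe_sub, hF.2, hG.2, sub_self]
    obtain ⟨n, hn⟩ := AddCircle.coe_eq_zero_iff (1 : ℝ) |>.1 h
    exact ⟨n, by simpa using hn⟩
  choose n hn using hint
  have hcont : Continuous fun x => F x - G x := hF.1.sub hG.1
  have hn' : Continuous n := by
    have : Continuous fun x => ((n x : ℤ) : ℝ) := by simpa only [hn] using hcont
    exact Int.isClosedEmbedding_coe_real.isEmbedding.continuous_iff.2 this
  refine ⟨n 0, funext fun x => ?_⟩
  have := PreconnectedSpace.constant inferInstance hn' (x := x) (y := 0)
  rw [← this, hn]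
  ring

/-- The derivatives of a circle map are those of any of its lifts. -/
theorem circleDeriv_eq {F : ℝ → ℝ} {f : Circ → Circ} (hF : IsLift F f) {j : ℕ} (hj : 1 ≤ j) :
    circleDeriv j f = iteratedDeriv j F := by
  have hex : ∃ F, IsLift F f := ⟨F, hF⟩
  have hl : IsLift (lift f) f := by
    unfold lift
    rw [dif_pos hex]
    exact hex.choose_spec
  obtain ⟨c, hc⟩ := hl.sub_const hF
  obtain ⟨j, rfl⟩ : ∃ i, j = i + 1 := ⟨j - 1, by omega⟩
  unfold circleDeriv
  rw [hc, iteratedDeriv_succ', iteratedDeriv_succ']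
  congr 1
  funext x
  simp

/-- The integer part of a finite regularity exponent `α`. -/
def intPart (α : ℝ≥0∞) : ℕ := ⌊α.toNNReal⌋₊

/-- The fractional part of a finite regularity exponent `α`. -/
def fracPart (α : ℝ≥0∞) : ℝ≥0 := α.toNNReal - intPart α

/-- `F` (a lift of a circle map) is of class `C^α`. For finite `α = k + β`, with `k` a positive
integer and `0 ≤ β < 1`, this is `C^k` with `β`-Hölder `k`-th derivative; for a lift of a circle
map the Hölder condition is void if `β = 0`. For `α = ∞` it is `C^∞`. -/
def IsClass (α : ℝ≥0∞) (F : ℝ → ℝ) : Prop :=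
  if α = ⊤ then ContDiff ℝ ((⊤ : ℕ∞) : WithTop ℕ∞) F
  else ContDiff ℝ (intPart α) F ∧ MemHolder (fracPart α) (iteratedDeriv (intPart α) F)

/-- The `C^{k+β}` distance of two circle maps: uniform distance of the values and of the
derivatives of order `1, …, k`, plus the `β`-Hölder seminorm of the difference of the `k`-th
derivatives. (If `β = 0` that last term is the oscillation, at most twice a term already in the
sum, so that the distance is equivalent to the usual `C^k` one.) -/
def classEDist (k : ℕ) (β : ℝ≥0) (f g : Circ → Circ) : ℝ≥0∞ :=
  (⨆ x : Circ, edist (f x) (g x)) +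
    (∑ j ∈ Finset.Icc 1 k, ⨆ x : ℝ, edist (circleDeriv j f x) (circleDeriv j g x)) +
    eHolderNorm β (circleDeriv k f - circleDeriv k g)

theorem iSup_edist_triangle {X Y : Type*} [PseudoEMetricSpace Y] (u v w : X → Y) :
    (⨆ x, edist (u x) (w x)) ≤ (⨆ x, edist (u x) (v x)) + ⨆ x, edist (v x) (w x) :=
  iSup_le fun x => (edist_triangle _ (v x) _).trans
    (add_le_add (le_iSup (fun x => edist (u x) (v x)) x) (le_iSup (fun x => edist (v x) (w x)) x))

/-- The `C^{k+β}` distance is an extended pseudometric. -/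
@[reducible]
def classPseudoEMetric (k : ℕ) (β : ℝ≥0) : PseudoEMetricSpace (Circ → Circ) where
  edist := classEDist k β
  edist_self f := by simp [classEDist]
  edist_comm f g := by
    have h : circleDeriv k f - circleDeriv k g = -(circleDeriv k g - circleDeriv k f) := by abel
    unfold classEDist
    have hn : eHolderNorm β (-(circleDeriv k g - circleDeriv k f)) =
        eHolderNorm β (circleDeriv k g - circleDeriv k f) := by
      simpa using eHolderNorm_smul (r := β) (f := circleDeriv k g - circleDeriv k f) (-1 : ℝ)
    rw [h, hn]
    simp only [edist_comm]
  edist_triangle f g h := by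
    have hs : circleDeriv k f - circleDeriv k h
        = (circleDeriv k f - circleDeriv k g) + (circleDeriv k g - circleDeriv k h) := by abel
    have h1 := iSup_edist_triangle f g h
    have h2 : (∑ j ∈ Finset.Icc 1 k, ⨆ x : ℝ, edist (circleDeriv j f x) (circleDeriv j h x)) ≤
        (∑ j ∈ Finset.Icc 1 k, ⨆ x : ℝ, edist (circleDeriv j f x) (circleDeriv j g x)) +
        ∑ j ∈ Finset.Icc 1 k, ⨆ x : ℝ, edist (circleDeriv j g x) (circleDeriv j h x) := by
      rw [← Finset.sum_add_distrib]
      exact Finset.sum_le_sum fun j _ => iSup_edist_triangle _ _ _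
    have h3 : eHolderNorm β (circleDeriv k f - circleDeriv k h) ≤
        eHolderNorm β (circleDeriv k f - circleDeriv k g) +
        eHolderNorm β (circleDeriv k g - circleDeriv k h) := by
      rw [hs]
      exact eHolderNorm_add_le
    unfold classEDist
    refine (add_le_add (add_le_add h1 h2) h3).trans (le_of_eq ?_)
    ring

/-- The `C^α` topology; for `α = ∞` it is generated by all the `C^k` distances. -/
@[reducible]
def classTopology (α : ℝ≥0∞) : TopologicalSpace (Circ → Circ) :=
  if α = ⊤ then ⨅ k : ℕ, (classPseudoEMetric k 0).toUniformSpace.toTopologicalSpace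
  else (classPseudoEMetric (intPart α) (fracPart α)).toUniformSpace.toTopologicalSpace

/-- `f` is an expanding Markov map of the circle of class `C^α`: a local homeomorphism of class
`C^α` whose derivative is, in absolute value, larger than some `γ > 1` everywhere, and such that
finitely many points cut the circle into open arcs, each of which `f` maps bijectively onto the
circle with one point removed. -/
structure IsExpandingMarkov (α : ℝ≥0∞) (f : Circ → Circ) : Prop where
  isLocalHomeomorph : IsLocalHomeomorph f
  smooth_expanding : ∃ F : ℝ → ℝ, IsLift F f ∧ IsClass α F ∧
    ∃ γ : ℝ, 1 < γ ∧ ∀ x : ℝ, γ < |deriv F x|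
  full_branches : ∃ (X : Finset Circ) (p : Circ), X.Nonempty ∧
    ∀ x ∈ ((X : Set Circ)ᶜ : Set Circ),
      Set.BijOn f (connectedComponentIn ((X : Set Circ)ᶜ) x) {p}ᶜ

/-- The space `E^α` of expanding Markov maps of the circle of class `C^α`. -/
structure ExpandingMarkovMap (α : ℝ≥0∞) where
  toFun : Circ → Circ
  isExpandingMarkov : IsExpandingMarkov α toFun

instance (α : ℝ≥0∞) : CoeFun (ExpandingMarkovMap α) (fun _ => Circ → Circ) :=
  ⟨ExpandingMarkovMap.toFun⟩

/-- `E^α` carries the `C^α` topology. -/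
instance (α : ℝ≥0∞) : TopologicalSpace (ExpandingMarkovMap α) :=
  TopologicalSpace.induced ExpandingMarkovMap.toFun (classTopology α)

/-- A Markov partition for `φ`: finitely many closed arcs that cover the circle, with pairwise
disjoint interiors, such that `φ` is injective on the interior of each arc and maps it onto a set
containing the interior of every arc which it meets. In particular the image of each arc is a
union of arcs of the partition. -/
structure IsMarkovPartition (φ : Circ → Circ) {d : ℕ} (P : Fin d → Set Circ) : Prop where
  arc : ∀ i, ∃ a b : ℝ, a < b ∧ b < a + 1 ∧ P i = (fun t : ℝ => (t : Circ)) '' Set.Icc a b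
  cover : ⋃ i, P i = Set.univ
  disjoint_interior : Pairwise fun i j => Disjoint (interior (P i)) (interior (P j))
  injOn : ∀ i, Set.InjOn φ (interior (P i))
  markov : ∀ i j, (φ '' interior (P i) ∩ interior (P j)).Nonempty →
    interior (P j) ⊆ φ '' interior (P i)

/-- The one-sided sequences on `d` symbols in which no word of the finite list `W` of forbidden
words occurs. -/
def subshiftOfFiniteType {d : ℕ} (W : Finset (List (Fin d))) : Set (ℕ → Fin d) :=
  {s | ∀ w ∈ W, ∀ n : ℕ, List.ofFn (fun i : Fin w.length => s (n + i)) ≠ w}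

/-- The point `x` is coded by `s` with respect to `φ` and the Markov partition `P`: it lies in the
closed cylinder of every initial word of `s`. Closures of the open cylinders are taken, since an
endpoint of an arc is coded only by the itineraries of the points near it on one side. -/
def Codes (φ : Circ → Circ) {d : ℕ} (P : Fin d → Set Circ) (s : ℕ → Fin d) (x : Circ) : Prop :=
  ∀ n : ℕ, x ∈ closure (⋂ j ∈ Set.Iio n, φ^[j] ⁻¹' interior (P (s j)))

/-- `K` is a subshift of finite type for `φ`: the set of points coded, through some Markov
partition of `φ`, by the sequences of a subshift of finite type. -/
def IsSFT (φ : Circ → Circ) (K : Set Circ) : Prop :=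
  ∃ (d : ℕ) (P : Fin d → Set Circ) (W : Finset (List (Fin d))),
    IsMarkovPartition φ P ∧
      K = {x | ∃ s ∈ subshiftOfFiniteType W, Codes φ P s x}

end ExpandingCircle

end

/-!
A residual set of maps is found by rotating: if `f` is in `E ^ α`, so is `x ↦ f x + t`, and it tends
to `f` in the `C ^ α` topology as `t → 0`. For a compact set `K`, the condition `f(K) ∩ K = ∅` is
open in `f` already for uniform convergence. The rotations `t` for which `f(K) + t` meets `K` form
the difference set `K - f(K)`, a Lipschitz image of `K × K`. If the box dimension of `K` is less than
`1 / 2`, this set is null (`volume_setOf_add_mem_eq_zero`). A countable union of null sets is null, so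
if there are only countably many sets `K` to avoid, almost every small rotation of `f` avoids all of
them at once, and the countable intersection of the open conditions is dense. Completeness of
`E ^ α` is not needed.

Two facts about an expanding map `φ` of class `C ^ α`, `α > 1`, are used.

* **Box and Hausdorff dimension agree on invariant sets.** By Hölder continuity of the derivative and
  the mean value theorem, `φ` multiplies all the distances inside a small set by nearly the same
  factor (`IsQuasiConformalExpanding`). The errors along an orbit segment form a geometric series, so
  that every set of diameter at most `L` is blown up by an iterate of `φ` to a fixed size, with bounded
  distortion (`IsQuasiConformalExpanding.exists_iterate_dist_le`). If `K` is compact, forward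
  invariant and `H ^ s (K) = 0`, take a finite cover of `K` by sets whose diameters have a very small
  sum of `s`-th powers. Pulling it back refines each piece of a cover without increasing the sum
  of `s`-th powers; doing so until all pieces have diameter about `r` leaves `O(r ^ (-s))` pieces
  (`IsQuasiConformalExpanding.exists_card_cover_le`).
* **There are countably many subshifts of finite type.** The finite set of endpoints of the arcs of a
  Markov partition is mapped into itself (`IsMarkovPartition.mapsTo_partitionBoundary`), so it consists
  of preperiodic points, and these are countable in number since `φ` is expanding
  (`IsQuasiConformalExpanding.countable_preperiodic`).
-/

noncomputable section

namespace ExpandingCircle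

open MeasureTheory Topology

/-! ### Bounded distortion for expanding maps -/

/-- `φ` expands distances up to `δ` at least by the factor `γ`, and on a set of diameter at most
`ρ ≤ δ` the factors by which it stretches two distances differ at most by the factor
`1 + H * ρ ^ β`. The condition on the factors is written without division, so that it holds for
pairs of equal points as well. -/
structure IsQuasiConformalExpanding {X : Type*} [MetricSpace X] (φ : X → X)
    (δ γ H β : ℝ) : Prop where
  delta_pos : 0 < δ
  one_lt_gamma : 1 < γ
  H_nonneg : 0 ≤ H
  beta_pos : 0 < β
  expand : ∀ x y, dist x y ≤ δ → γ * dist x y ≤ dist (φ x) (φ y)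
  distortion : ∀ (S : Set X) (ρ : ℝ), 0 ≤ ρ → ρ ≤ δ → (∀ x ∈ S, ∀ y ∈ S, dist x y ≤ ρ) →
    ∀ x ∈ S, ∀ y ∈ S, ∀ x' ∈ S, ∀ y' ∈ S,
      dist (φ x') (φ y') * dist x y ≤ (1 + H * ρ ^ β) * (dist x' y' * dist (φ x) (φ y))

namespace IsQuasiConformalExpanding

variable {X : Type*} [MetricSpace X] {φ : X → X} {δ γ H β : ℝ}

theorem pow_mul_dist_le (h : IsQuasiConformalExpanding φ δ γ H β) {x y : X} {m : ℕ}
    (hm : ∀ j < m, dist (φ^[j] x) (φ^[j] y) ≤ δ) :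
    γ ^ m * dist x y ≤ dist (φ^[m] x) (φ^[m] y) := by
  induction m with
  | zero => simp
  | succ m ih =>
    have h1 := ih fun j hj => hm j (by omega)
    have h2 := h.expand _ _ (hm m (by omega))
    rw [Function.iterate_succ_apply', Function.iterate_succ_apply', pow_succ']
    have := h.one_lt_gamma
    nlinarith

theorem dist_iterate_pos (h : IsQuasiConformalExpanding φ δ γ H β) {x y : X} {m : ℕ}
    (hm : ∀ j < m, dist (φ^[j] x) (φ^[j] y) ≤ δ) (hxy : x ≠ y) :
    0 < dist (φ^[m] x) (φ^[m] y) := by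
  have := h.one_lt_gamma
  have h0 : 0 < dist x y := dist_pos.2 hxy
  exact lt_of_lt_of_le (by positivity) (h.pow_mul_dist_le hm)

/-- Bounded distortion along an orbit segment, with one factor for each step. -/
theorem dist_iterate_mul_dist_le (h : IsQuasiConformalExpanding φ δ γ H β) {U : Set X} {m : ℕ}
    {ρ : ℕ → ℝ} (hρ0 : ∀ i < m, 0 ≤ ρ i) (hρδ : ∀ i < m, ρ i ≤ δ)
    (hU : ∀ i < m, ∀ x ∈ U, ∀ y ∈ U, dist (φ^[i] x) (φ^[i] y) ≤ ρ i)
    {x y x' y' : X} (hx : x ∈ U) (hy : y ∈ U) (hx' : x' ∈ U) (hy' : y' ∈ U)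
    (hxy : x ≠ y) (hxy' : x' ≠ y') :
    dist (φ^[m] x') (φ^[m] y') * dist x y ≤
      Real.exp (∑ i ∈ Finset.range m, H * ρ i ^ β) * (dist x' y' * dist (φ^[m] x) (φ^[m] y)) := by
  induction m with
  | zero => simp [mul_comm]
  | succ m ih =>
    have ih := ih (fun i hi => hρ0 i (by omega)) (fun i hi => hρδ i (by omega))
      (fun i hi => hU i (by omega))
    have hpos : 0 < dist (φ^[m] x) (φ^[m] y) := h.dist_iterate_pos
      (fun j hj => (hU j (by omega) x hx y hy).trans (hρδ j (by omega))) hxy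
    have hpos' : 0 < dist (φ^[m] x') (φ^[m] y') := h.dist_iterate_pos
      (fun j hj => (hU j (by omega) x' hx' y' hy').trans (hρδ j (by omega))) hxy'
    have hstep := h.distortion (φ^[m] '' U) (ρ m) (hρ0 m (by omega)) (hρδ m (by omega))
      (by rintro _ ⟨a, ha, rfl⟩ _ ⟨b, hb, rfl⟩; exact hU m (by omega) a ha b hb)
      _ ⟨x, hx, rfl⟩ _ ⟨y, hy, rfl⟩ _ ⟨x', hx', rfl⟩ _ ⟨y', hy', rfl⟩
    have hexp : 1 + H * ρ m ^ β ≤ Real.exp (H * ρ m ^ β) := by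
      rw [add_comm]; exact Real.add_one_le_exp _
    rw [Finset.sum_range_succ, Real.exp_add]
    simp only [Function.iterate_succ_apply']
    set E := Real.exp (∑ i ∈ Finset.range m, H * ρ i ^ β)
    set e := Real.exp (H * ρ m ^ β)
    set a := dist (φ^[m] x) (φ^[m] y)
    set A := dist (φ^[m] x') (φ^[m] y')
    set b := dist (φ (φ^[m] x)) (φ (φ^[m] y))
    set B := dist (φ (φ^[m] x')) (φ (φ^[m] y'))
    have hstep' : B * a ≤ e * (A * b) := hstep.trans (by gcongr)
    refine le_of_mul_le_mul_right ?_ (mul_pos hpos hpos')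
    calc B * dist x y * (a * A) = (B * a) * (A * dist x y) := by ring
      _ ≤ (e * (A * b)) * (E * (dist x' y' * a)) := by gcongr
      _ = E * e * (dist x' y' * b) * (a * A) := by ring

/-- Sets are blown up to a fixed size by an iterate which distorts distances by a bounded factor
only. -/
theorem exists_iterate_dist_le (h : IsQuasiConformalExpanding φ δ γ H β) :
    ∃ C : ℝ, 0 < C ∧ ∀ (U : Set X) (L : ℝ), (∀ x ∈ U, ∀ y ∈ U, dist x y ≤ L) →
      ∃ n : ℕ, ∀ x ∈ U, ∀ y ∈ U, dist x y ≤ C * L * dist (φ^[n] x) (φ^[n] y) := by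
  have hδ := h.delta_pos
  have hγ := h.one_lt_gamma
  have hβ := h.beta_pos
  have hH := h.H_nonneg
  set q : ℝ := γ⁻¹ ^ β with hq
  have hq0 : 0 ≤ q := by positivity
  have hq1 : q < 1 := Real.rpow_lt_one (by positivity) (inv_lt_one_of_one_lt₀ hγ) hβ
  set D := H * δ ^ β * (1 - q)⁻¹ with hD
  refine ⟨Real.exp D / δ, by positivity, fun U L hUL => ?_⟩
  by_cases hsub : U.Subsingleton
  · exact ⟨0, fun x hx y hy => by simp [hsub hx hy]⟩
  have hex : ∃ n : ℕ, ∃ x ∈ U, ∃ y ∈ U, δ < dist (φ^[n] x) (φ^[n] y) := by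
    by_contra! hcon
    obtain ⟨x, hx, y, hy, hxy⟩ := Set.not_subsingleton_iff.1 hsub
    have h0 : 0 < dist x y := dist_pos.2 hxy
    obtain ⟨n, hn⟩ := pow_unbounded_of_one_lt (δ / dist x y) hγ
    have h1 := h.pow_mul_dist_le (x := x) (y := y) (m := n) fun j _ => hcon j x hx y hy
    have h2 := hcon n x hx y hy
    rw [div_lt_iff₀ h0] at hn
    linarith
  classical
  -- the first time at which two points of `U` are more than `δ` apart
  set n := Nat.find hex with hn
  obtain ⟨x', hx', y', hy', hbig⟩ := Nat.find_spec hex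
  have hmin : ∀ i < n, ∀ x ∈ U, ∀ y ∈ U, dist (φ^[i] x) (φ^[i] y) ≤ δ := by
    intro i hi x hx y hy
    by_contra! hlt
    exact Nat.find_min hex hi ⟨x, hx, y, hy, hlt⟩
  have hxy' : x' ≠ y' := by
    rintro rfl
    rw [dist_self] at hbig
    linarith
  set ρ : ℕ → ℝ := fun i => δ * γ⁻¹ ^ (n - 1 - i) with hρ
  have hρδ : ∀ i, ρ i ≤ δ := fun i =>
    mul_le_of_le_one_right hδ.le (pow_le_one₀ (by positivity) (inv_le_one_of_one_le₀ hγ.le))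
  -- going backwards from the last time before separation, distances contract at rate `γ⁻¹`
  have hU : ∀ i < n, ∀ x ∈ U, ∀ y ∈ U, dist (φ^[i] x) (φ^[i] y) ≤ ρ i := by
    intro i hi x hx y hy
    have h1 := h.pow_mul_dist_le (x := φ^[i] x) (y := φ^[i] y) (m := n - 1 - i) (fun j hj => by
      rw [← Function.iterate_add_apply, ← Function.iterate_add_apply]
      exact hmin _ (by omega) x hx y hy)
    rw [← Function.iterate_add_apply, ← Function.iterate_add_apply] at h1
    have h2 := h1.trans (hmin _ (by omega) x hx y hy)
    simp only [hρ, inv_pow]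
    rw [← div_eq_mul_inv, le_div_iff₀ (by positivity), mul_comm]
    exact h2
  have hsum : ∑ i ∈ Finset.range n, H * ρ i ^ β ≤ D := by
    have h1 : ∀ i, H * ρ i ^ β = H * δ ^ β * q ^ (n - 1 - i) := by
      intro i
      simp only [hρ]
      rw [Real.mul_rpow hδ.le (by positivity), hq, ← Real.rpow_natCast, ← Real.rpow_natCast,
        ← Real.rpow_mul (by positivity), ← Real.rpow_mul (by positivity),
        mul_comm (((n - 1 - i : ℕ)) : ℝ) β]
      ring
    simp only [h1]
    rw [← Finset.mul_sum, Finset.sum_range_reflect (fun j => q ^ j) n, hD]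
    gcongr
    exact (Summable.sum_le_tsum _ (fun i _ => by positivity)
      (summable_geometric_of_lt_one hq0 hq1)).trans_eq (tsum_geometric_of_lt_one hq0 hq1)
  refine ⟨n, fun x hx y hy => ?_⟩
  by_cases hxy : x = y
  · simp [hxy]
  have key := h.dist_iterate_mul_dist_le (m := n) (ρ := ρ) (fun i _ => by positivity)
    (fun i _ => hρδ i) hU hx hy hx' hy' hxy hxy'
  have h1 : δ * dist x y ≤ Real.exp D * (L * dist (φ^[n] x) (φ^[n] y)) := by
    calc δ * dist x y ≤ dist (φ^[n] x') (φ^[n] y') * dist x y := by gcongr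
      _ ≤ _ := key
      _ ≤ _ := by
        gcongr
        exact hUL x' hx' y' hy'
  rw [div_mul_eq_mul_div, div_mul_eq_mul_div, le_div_iff₀ hδ]
  linarith

end IsQuasiConformalExpanding

/-! ### Box counting for invariant sets -/

/-- A compact set of zero `s`-dimensional Hausdorff measure has finite covers of arbitrarily small
`s`-dimensional size. -/
theorem exists_finite_cover_of_hausdorffMeasure_eq_zero {X : Type*} [MetricSpace X]
    [MeasurableSpace X] [BorelSpace X] {K : Set X} (hK : IsCompact K) {s : ℝ} (hs0 : 0 < s)
    (hs1 : s ≤ 1) (hμ : μH[s] K = 0) {ε : ℝ} (hε : 0 < ε) :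
    ∃ (I : Finset ℕ) (U : ℕ → Set X) (l : ℕ → ℝ), (∀ i, 0 < l i) ∧
      (∀ i, ∀ x ∈ U i, ∀ y ∈ U i, dist x y ≤ l i) ∧ K ⊆ ⋃ i ∈ I, U i ∧
      ∑ i ∈ I, l i ^ s ≤ ε := by
  rw [Measure.hausdorffMeasure_apply] at hμ
  have h1 := (iSup₂_eq_bot.1 hμ) 1 one_pos
  have h2 : (⨅ (t : ℕ → Set X) (_ : K ⊆ ⋃ n, t n) (_ : ∀ n, Metric.ediam (t n) ≤ 1),
      ∑' n, ⨆ _ : (t n).Nonempty, Metric.ediam (t n) ^ s) < ENNReal.ofReal (ε / 2) := by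
    rw [h1]; exact ENNReal.ofReal_pos.2 (half_pos hε)
  simp only [iInf_lt_iff] at h2
  obtain ⟨t, htK, htd, hts⟩ := h2
  have hfin : ∀ n, Metric.ediam (t n) ≠ ⊤ := fun n => ne_top_of_le_ne_top ENNReal.one_ne_top (htd n)
  have hsup : ∀ n, (⨆ _ : (t n).Nonempty, Metric.ediam (t n) ^ s) = Metric.ediam (t n) ^ s := by
    intro n
    rcases (t n).eq_empty_or_nonempty with h | h
    · simp [h, hs0]
    · simp [h]
  simp only [hsup] at hts
  obtain ⟨w, hw0, hwsum⟩ := (Set.countable_univ (α := ℕ)).exists_pos_forall_sum_le (half_pos hε)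
  -- thicken the `i`-th set by `η i`, which raises the sum of the `s`-th powers by at most `w i`
  set η : ℕ → ℝ := fun i => w i ^ s⁻¹ / 2 with hη
  have hη0 : ∀ i, 0 < η i := fun i => half_pos (Real.rpow_pos_of_pos (hw0 i) _)
  set l : ℕ → ℝ := fun i => Metric.diam (t i) + 2 * η i with hl
  set U : ℕ → Set X := fun i => Metric.thickening (η i) (t i) with hU
  obtain ⟨I, hI⟩ := hK.elim_finite_subcover U (fun i => Metric.isOpen_thickening)
    (htK.trans (Set.iUnion_mono fun i => Metric.self_subset_thickening (hη0 i) _))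
  have hl0 : ∀ i, 0 < l i := fun i => add_pos_of_nonneg_of_pos Metric.diam_nonneg
    (mul_pos two_pos (hη0 i))
  refine ⟨I, U, l, hl0, ?_, hI, ?_⟩
  · intro i x hx y hy
    obtain ⟨x', hx', hxx'⟩ := Metric.mem_thickening_iff.1 hx
    obtain ⟨y', hy', hyy'⟩ := Metric.mem_thickening_iff.1 hy
    have h3 := Metric.dist_le_diam_of_mem' (hfin i) hx' hy'
    have h4 := dist_triangle4 x x' y' y
    rw [dist_comm y' y] at h4
    simp only [hl]
    linarith
  · have hdiam : ∑ i ∈ I, Metric.diam (t i) ^ s ≤ ε / 2 := by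
      have h3 : ∑ i ∈ I, Metric.ediam (t i) ^ s ≤ ENNReal.ofReal (ε / 2) :=
        (ENNReal.sum_le_tsum I).trans hts.le
      have h4 := ENNReal.toReal_mono ENNReal.ofReal_ne_top h3
      rw [ENNReal.toReal_ofReal (half_pos hε).le, ENNReal.toReal_sum
        (fun i _ => ENNReal.rpow_ne_top_of_nonneg hs0.le (hfin i))] at h4
      simp only [← ENNReal.toReal_rpow] at h4
      exact h4
    have hterm : ∀ i, l i ^ s ≤ Metric.diam (t i) ^ s + w i := by
      intro i
      have h3 : (2 * η i) ^ s = w i := by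
        simp only [hη]
        rw [mul_div_cancel₀ _ (two_ne_zero), ← Real.rpow_mul (hw0 i).le,
          inv_mul_cancel₀ hs0.ne', Real.rpow_one]
      rw [← h3]
      exact Real.rpow_add_le_add_rpow Metric.diam_nonneg (by have := hη0 i; positivity) hs0.le hs1
    calc ∑ i ∈ I, l i ^ s ≤ ∑ i ∈ I, (Metric.diam (t i) ^ s + w i) :=
          Finset.sum_le_sum fun i _ => hterm i
      _ ≤ ε := by
        rw [Finset.sum_add_distrib]
        linarith [hwsum I (Set.subset_univ _)]

/-- **Box counting.** A compact forward invariant set of zero `s`-dimensional Hausdorff measure is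
covered by `O(r ^ (-s))` sets of diameter at most `r`. Indeed, a cover of the set by finitely many
pieces with a small sum of `s`-th powers of diameters is pulled back along the iterates of `φ` into
every piece, at every scale. -/
theorem IsQuasiConformalExpanding.exists_card_cover_le {X : Type*} [MetricSpace X]
    [MeasurableSpace X] [BorelSpace X] {φ : X → X} {δ γ H β : ℝ}
    (h : IsQuasiConformalExpanding φ δ γ H β) {K : Set X} (hK : IsCompact K)
    (hφK : Set.MapsTo φ K K) {s : ℝ} (hs0 : 0 < s) (hs1 : s ≤ 1) (hμ : μH[s] K = 0) :
    ∃ A : ℝ, 0 ≤ A ∧ ∀ r : ℝ, 0 < r → r ≤ 1 → ∃ T : Finset (Set X), K ⊆ ⋃ S ∈ T, S ∧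
      (∀ S ∈ T, ∀ x ∈ S, ∀ y ∈ S, dist x y ≤ r) ∧ (T.card : ℝ) ≤ A * r ^ (-s) := by
  classical
  obtain ⟨C, hC, hblow⟩ := h.exists_iterate_dist_le
  obtain ⟨I, U, l, hl0, hUl, hKU, hsum⟩ := exists_finite_cover_of_hausdorffMeasure_eq_zero hK hs0 hs1
    hμ (ε := (C ^ s)⁻¹ / 2) (by positivity)
  have hsum' : ∑ i ∈ I, (C * l i) ^ s ≤ 1 / 2 := by
    have h1 : ∀ i, (C * l i) ^ s = C ^ s * l i ^ s := fun i => Real.mul_rpow hC.le (hl0 i).le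
    simp only [h1]
    rw [← Finset.mul_sum]
    calc C ^ s * ∑ i ∈ I, l i ^ s ≤ C ^ s * ((C ^ s)⁻¹ / 2) := by gcongr
      _ = 1 / 2 := by field_simp
  set θ : ℝ := (1 / 2 : ℝ) ^ s⁻¹ with hθ
  have hθ0 : 0 < θ := by positivity
  have hθ1 : θ < 1 := Real.rpow_lt_one (by norm_num) (by norm_num) (by positivity)
  have hlθ : ∀ i ∈ I, C * l i ≤ θ := by
    intro i hi
    have h0 : 0 ≤ C * l i := (mul_pos hC (hl0 i)).le
    have h1 : (C * l i) ^ s ≤ 1 / 2 := (Finset.single_le_sum (f := fun i => (C * l i) ^ s)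
      (fun j _ => Real.rpow_nonneg (mul_pos hC (hl0 j)).le _) hi).trans hsum'
    have h2 := Real.rpow_le_rpow (Real.rpow_nonneg h0 s) h1 (z := s⁻¹) (by positivity)
    rwa [← Real.rpow_mul h0, mul_inv_cancel₀ hs0.ne', Real.rpow_one] at h2
  obtain ⟨m, hm0, hm1, hml⟩ : ∃ m : ℝ, 0 < m ∧ m ≤ 1 ∧ ∀ i ∈ I, m ≤ C * l i := by
    obtain ⟨m, hm0, hm⟩ : ∃ m : ℝ, 0 < m ∧ ∀ i ∈ I, m ≤ C * l i := by
      rcases I.eq_empty_or_nonempty with rfl | hI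
      · exact ⟨1, one_pos, by simp⟩
      · obtain ⟨i, -, hi⟩ := I.exists_min_image (fun i => C * l i) hI
        exact ⟨C * l i, mul_pos hC (hl0 i), hi⟩
    exact ⟨min m 1, by positivity, min_le_right _ _, fun i hi => (min_le_left _ _).trans (hm i hi)⟩
  -- The size `L` is at least `m * r` throughout, where `m` bounds the ratios of sizes in one step from
  -- below; the factor `m ^ (-s)` makes the bound at least `1` when `L ≤ r` and one set is enough.
  -- Since `θ` bounds those ratios from above, `n` steps suffice if `L * θ ^ n ≤ r`.
  have hcount : ∀ r : ℝ, 0 < r → ∀ n : ℕ, ∀ L : ℝ, m * r ≤ L → L * θ ^ n ≤ r → ∀ V : Set X,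
      (∀ x ∈ V, ∀ y ∈ V, dist x y ≤ L) → ∃ T : Finset (Set X), K ∩ V ⊆ ⋃ S ∈ T, S ∧
        (∀ S ∈ T, ∀ x ∈ S, ∀ y ∈ S, dist x y ≤ r) ∧ (T.card : ℝ) ≤ m ^ (-s) * (L / r) ^ s := by
    intro r hr n
    induction n with
    | zero =>
      intro L hmL hLr V hV
      refine ⟨{V}, by simp, ?_, ?_⟩
      · intro S hS x hx y hy
        obtain rfl := Finset.mem_singleton.1 hS
        exact (hV x hx y hy).trans (by simpa using hLr)
      · have h1 : m ≤ L / r := by rwa [le_div_iff₀ hr]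
        calc (({V} : Finset (Set X)).card : ℝ) = m ^ (-s) * m ^ s := by
              rw [← Real.rpow_add hm0]; simp
          _ ≤ _ := by gcongr
    | succ n ih =>
      intro L hmL hLr V hV
      have hL0 : 0 < L := (mul_pos hm0 hr).trans_le hmL
      obtain hLr' | hLr' := le_or_gt L r
      · refine ih L hmL ((mul_le_of_le_one_right hL0.le (pow_le_one₀ hθ0.le hθ1.le)).trans hLr') V hV
      obtain ⟨k, hk⟩ := hblow V L hV
      have hstep : ∀ i, ∃ T : Finset (Set X), i ∈ I → K ∩ (V ∩ φ^[k] ⁻¹' U i) ⊆ ⋃ S ∈ T, S ∧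
          (∀ S ∈ T, ∀ x ∈ S, ∀ y ∈ S, dist x y ≤ r) ∧
          (T.card : ℝ) ≤ m ^ (-s) * ((C * l i * L) / r) ^ s := by
        intro i
        by_cases hi : i ∈ I
        · obtain ⟨T, hT⟩ := ih (C * l i * L)
            (mul_le_mul (hml i hi) hLr'.le hr.le (mul_pos hC (hl0 i)).le)
            (by
              calc C * l i * L * θ ^ n ≤ θ * L * θ ^ n := by gcongr; exact hlθ i hi
                _ = L * θ ^ (n + 1) := by ring
                _ ≤ r := hLr)
            (V ∩ φ^[k] ⁻¹' U i) (by
              intro x hx y hy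
              have h1 := hk x hx.1 y hy.1
              have h2 := hUl i _ hx.2 _ hy.2
              calc dist x y ≤ C * L * dist (φ^[k] x) (φ^[k] y) := h1
                _ ≤ C * L * l i := by gcongr
                _ = C * l i * L := by ring)
          exact ⟨T, fun _ => hT⟩
        · exact ⟨∅, fun h => absurd h hi⟩
      choose T hT using hstep
      refine ⟨I.biUnion T, ?_, ?_, ?_⟩
      · rintro x ⟨hxK, hxV⟩
        obtain ⟨i, hi, hxi⟩ := Set.mem_iUnion₂.1 (hKU (hφK.iterate k hxK))
        obtain ⟨S, hS, hxS⟩ := Set.mem_iUnion₂.1 ((hT i hi).1 ⟨hxK, hxV, hxi⟩)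
        exact Set.mem_iUnion₂.2 ⟨S, Finset.mem_biUnion.2 ⟨i, hi, hS⟩, hxS⟩
      · intro S hS
        obtain ⟨i, hi, hS⟩ := Finset.mem_biUnion.1 hS
        exact (hT i hi).2.1 S hS
      · have h1 : ∀ i, m ^ (-s) * ((C * l i * L) / r) ^ s =
            m ^ (-s) * (L / r) ^ s * (C * l i) ^ s := by
          intro i
          have h0 := (mul_pos hC (hl0 i)).le
          rw [mul_div_assoc, Real.mul_rpow h0 (by positivity)]
          ring
        calc ((I.biUnion T).card : ℝ) ≤ ((∑ i ∈ I, (T i).card : ℕ) : ℝ) := by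
              exact_mod_cast Finset.card_biUnion_le
          _ = ∑ i ∈ I, ((T i).card : ℝ) := by push_cast; rfl
          _ ≤ ∑ i ∈ I, m ^ (-s) * (L / r) ^ s * (C * l i) ^ s :=
            Finset.sum_le_sum fun i hi => (hT i hi).2.2.trans_eq (h1 i)
          _ ≤ m ^ (-s) * (L / r) ^ s := by
            rw [← Finset.mul_sum]
            exact mul_le_of_le_one_right (by positivity) (hsum'.trans (by norm_num))
  set L : ℝ := max 1 (Metric.diam K) with hL
  have hL1 : 1 ≤ L := le_max_left _ _
  refine ⟨m ^ (-s) * L ^ s, by positivity, fun r hr hr1 => ?_⟩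
  obtain ⟨n, hn⟩ := exists_pow_lt_of_lt_one (div_pos hr (by positivity : 0 < L)) hθ1
  obtain ⟨T, hT1, hT2, hT3⟩ := hcount r hr n L ((mul_le_one₀ hm1 hr.le hr1).trans hL1)
    (by rw [lt_div_iff₀ (by positivity)] at hn; linarith) K
    (fun x hx y hy => (Metric.dist_le_diam_of_mem hK.isBounded hx hy).trans (le_max_right _ _))
  refine ⟨T, by simpa using hT1, hT2, hT3.trans_eq ?_⟩
  rw [Real.div_rpow (by positivity) hr.le, Real.rpow_neg hr.le]
  ring

/-! ### Difference sets of sets of small box dimension -/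

/-- A subset of the circle all of whose points are within `ρ` of each other has length at most
`2 * ρ`. -/
theorem volume_le_of_forall_dist_le {S : Set Circ} {ρ : ℝ}
    (hS : ∀ x ∈ S, ∀ y ∈ S, dist x y ≤ ρ) : volume S ≤ ENNReal.ofReal (2 * ρ) := by
  rcases S.eq_empty_or_nonempty with rfl | ⟨x, hx⟩
  · simp
  · refine (measure_mono fun y hy => Metric.mem_closedBall.2 (hS y hy x hx)).trans ?_
    rw [AddCircle.volume_closedBall]
    exact ENNReal.ofReal_le_ofReal (min_le_right _ _)

/-- The translates of a Lipschitz image of `K` that meet `K` form a null set of translations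
if `K` has box dimension less than `1 / 2`. -/
theorem volume_setOf_add_mem_eq_zero {K : Set Circ} {s A M : ℝ} (hs : s < 1 / 2) (hA : 0 ≤ A)
    (hcov : ∀ r : ℝ, 0 < r → r ≤ 1 → ∃ T : Finset (Set Circ), K ⊆ ⋃ S ∈ T, S ∧
      (∀ S ∈ T, ∀ x ∈ S, ∀ y ∈ S, dist x y ≤ r) ∧ (T.card : ℝ) ≤ A * r ^ (-s))
    {f : Circ → Circ} (hM : 0 ≤ M) (hf : ∀ x y, dist (f x) (f y) ≤ M * dist x y) :
    volume {t : Circ | ∃ x ∈ K, f x + t ∈ K} = 0 := by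
  have hbound : ∀ r : ℝ, 0 < r → r ≤ 1 → volume {t : Circ | ∃ x ∈ K, f x + t ∈ K} ≤
      ENNReal.ofReal (A ^ 2 * (2 * (1 + M)) * r ^ (1 - 2 * s)) := by
    intro r hr hr1
    obtain ⟨T, hKT, hTr, hTc⟩ := hcov r hr hr1
    set Q : Set Circ × Set Circ → Set Circ := fun p => {t | ∃ x ∈ p.1, f x + t ∈ p.2} with hQ
    have hsub : {t : Circ | ∃ x ∈ K, f x + t ∈ K} ⊆ ⋃ p ∈ T ×ˢ T, Q p := by
      rintro t ⟨x, hx, hxt⟩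
      obtain ⟨S, hS, hxS⟩ := Set.mem_iUnion₂.1 (hKT hx)
      obtain ⟨S', hS', hxS'⟩ := Set.mem_iUnion₂.1 (hKT hxt)
      exact Set.mem_iUnion₂.2 ⟨(S, S'), Finset.mem_product.2 ⟨hS, hS'⟩, x, hxS, hxS'⟩
    have hvol : ∀ p ∈ T ×ˢ T, volume (Q p) ≤ ENNReal.ofReal (2 * ((1 + M) * r)) := by
      intro p hp
      obtain ⟨hp1, hp2⟩ := Finset.mem_product.1 hp
      refine volume_le_of_forall_dist_le ?_
      rintro t ⟨x, hx, hxt⟩ u ⟨y, hy, hyu⟩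
      have h1 := hTr _ hp2 _ hxt _ hyu
      have h2 := hTr _ hp1 _ hx _ hy
      have h3 : dist t u ≤ dist (f x + t) (f y + u) + dist (f x) (f y) := by
        rw [dist_eq_norm, dist_eq_norm, dist_eq_norm]
        have : t - u = (f x + t - (f y + u)) - (f x - f y) := by abel
        rw [this]
        exact norm_sub_le _ _
      have h4 := hf x y
      nlinarith
    have hcard : (((T ×ˢ T).card : ℕ) : ℝ) ≤ A ^ 2 * r ^ (-(2 * s)) := by
      rw [Finset.card_product]
      push_cast
      calc (T.card : ℝ) * T.card ≤ (A * r ^ (-s)) * (A * r ^ (-s)) := by gcongr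
        _ = A ^ 2 * (r ^ (-s) * r ^ (-s)) := by ring
        _ = A ^ 2 * r ^ (-(2 * s)) := by rw [← Real.rpow_add hr]; ring_nf
    calc volume {t : Circ | ∃ x ∈ K, f x + t ∈ K} ≤ ∑ p ∈ T ×ˢ T, volume (Q p) :=
          (measure_mono hsub).trans (measure_biUnion_finset_le _ _)
      _ ≤ ∑ p ∈ T ×ˢ T, ENNReal.ofReal (2 * ((1 + M) * r)) := Finset.sum_le_sum hvol
      _ = ENNReal.ofReal ((T ×ˢ T).card * (2 * ((1 + M) * r))) := by
        rw [Finset.sum_const, nsmul_eq_mul, ENNReal.ofReal_mul (Nat.cast_nonneg _),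
          ENNReal.ofReal_natCast]
      _ ≤ _ := by
        refine ENNReal.ofReal_le_ofReal ?_
        calc ((T ×ˢ T).card : ℝ) * (2 * ((1 + M) * r))
            ≤ A ^ 2 * r ^ (-(2 * s)) * (2 * ((1 + M) * r)) := by gcongr
          _ = A ^ 2 * (2 * (1 + M)) * (r ^ (-(2 * s)) * r ^ (1 : ℝ)) := by
            rw [Real.rpow_one]; ring
          _ = _ := by rw [← Real.rpow_add hr]; ring_nf
  have hlim : Filter.Tendsto
      (fun r : ℝ => ENNReal.ofReal (A ^ 2 * (2 * (1 + M)) * r ^ (1 - 2 * s)))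
      (nhdsWithin 0 (Set.Ioi 0)) (nhds 0) := by
    have h1 : Filter.Tendsto (fun r : ℝ => A ^ 2 * (2 * (1 + M)) * r ^ (1 - 2 * s))
        (nhds 0) (nhds (A ^ 2 * (2 * (1 + M)) * (0 : ℝ) ^ (1 - 2 * s))) :=
      ((Real.continuousAt_rpow_const 0 (1 - 2 * s) (Or.inr (by linarith))).tendsto).const_mul _
    rw [Real.zero_rpow (by linarith), mul_zero] at h1
    simpa using (ENNReal.tendsto_ofReal h1).mono_left nhdsWithin_le_nhds
  refine le_antisymm (ge_of_tendsto hlim ?_) bot_le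
  filter_upwards [Ioc_mem_nhdsGT (zero_lt_one' ℝ)] with r hr
  exact hbound r hr.1 hr.2

/-! ### Expanding circle maps of class `C ^ α` -/

theorem dist_coe_le (X Y : ℝ) : dist (X : Circ) (Y : Circ) ≤ |X - Y| := by
  rw [dist_eq_norm, ← AddCircle.coe_sub, UnitAddCircle.norm_eq]
  simpa using round_le (X - Y) 0

theorem dist_coe_eq {X Y : ℝ} (h : |X - Y| ≤ 1 / 2) : dist (X : Circ) (Y : Circ) = |X - Y| := by
  rw [dist_eq_norm, ← AddCircle.coe_sub, AddCircle.norm_coe_eq_abs_iff _ one_ne_zero]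
  simpa using h

/-- Every point of the circle has a lift which is as close to `Y` as the point is to the class of
`Y`. -/
theorem exists_coe_eq_abs_sub_eq_dist (x : Circ) (Y : ℝ) :
    ∃ X : ℝ, (X : Circ) = x ∧ |X - Y| = dist x (Y : Circ) := by
  obtain ⟨X, rfl⟩ := QuotientAddGroup.mk_surjective x
  refine ⟨X - round (X - Y), ?_, ?_⟩
  · rw [AddCircle.coe_sub]
    simp only [sub_eq_self]
    exact AddCircle.coe_eq_zero_iff (1 : ℝ) |>.2 ⟨round (X - Y), by simp⟩
  · change _ = dist (X : Circ) (Y : Circ)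
    rw [dist_eq_norm, ← AddCircle.coe_sub, UnitAddCircle.norm_eq]
    congr 1
    ring

theorem IsLift.exists_add_one {F : ℝ → ℝ} {f : Circ → Circ} (hF : IsLift F f) :
    ∃ c : ℝ, ∀ x, F (x + 1) = F x + c := by
  have hG : IsLift (fun x => F (x + 1)) f :=
    ⟨hF.1.comp (continuous_add_const 1), fun x => by rw [hF.2, AddCircle.coe_add_period]⟩
  obtain ⟨c, hc⟩ := hG.sub_const hF
  exact ⟨c, fun x => congrFun hc x⟩

theorem IsLift.periodic_deriv {F : ℝ → ℝ} {f : Circ → Circ} (hF : IsLift F f) :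
    Function.Periodic (deriv F) 1 := by
  obtain ⟨c, hc⟩ := hF.exists_add_one
  intro x
  rw [← deriv_comp_add_const, funext hc]
  simp

theorem exists_abs_le_of_periodic {g : ℝ → ℝ} (hg : Function.Periodic g 1) (hc : Continuous g) :
    ∃ M : ℝ, 0 ≤ M ∧ ∀ x, |g x| ≤ M := by
  obtain ⟨M, hM⟩ := (hg.compact_of_continuous one_ne_zero hc).isBounded.exists_norm_le
  exact ⟨M, (norm_nonneg _).trans (hM _ ⟨0, rfl⟩), fun x => hM _ ⟨x, rfl⟩⟩

theorem one_le_intPart {α : ℝ≥0∞} (hα : 1 < α) (htop : α ≠ ⊤) : 1 ≤ intPart α := by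
  have h1 : 1 < α.toNNReal := by
    rw [← ENNReal.coe_lt_coe, ENNReal.coe_toNNReal htop]; exact_mod_cast hα
  exact Nat.le_floor (by exact_mod_cast h1.le)

theorem IsClass.contDiff_one {α : ℝ≥0∞} (hα : 1 < α) {F : ℝ → ℝ} (h : IsClass α F) :
    ContDiff ℝ 1 F := by
  unfold IsClass at h
  split_ifs at h with htop
  · exact h.of_le (by exact_mod_cast le_top)
  · exact h.1.of_le (by exact_mod_cast one_le_intPart hα htop)

/-- A lift of class `C ^ α` with `1 < α` has a Hölder continuous derivative. -/
theorem IsClass.exists_holder_deriv {α : ℝ≥0∞} (hα : 1 < α) {F : ℝ → ℝ} {f : Circ → Circ}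
    (hF : IsLift F f) (h : IsClass α F) :
    ∃ H β : ℝ, 0 ≤ H ∧ 0 < β ∧ ∀ x y, |deriv F x - deriv F y| ≤ H * |x - y| ^ β := by
  have htwo : ContDiff ℝ 2 F →
      ∃ H β : ℝ, 0 ≤ H ∧ 0 < β ∧ ∀ x y, |deriv F x - deriv F y| ≤ H * |x - y| ^ β := by
    intro h2
    have h1 : ContDiff ℝ 1 (deriv F) :=
      (contDiff_succ_iff_deriv (n := 1).1 (by simpa [one_add_one_eq_two] using h2)).2.2
    have hper : Function.Periodic (deriv (deriv F)) 1 := by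
      intro x
      rw [← deriv_comp_add_const, funext hF.periodic_deriv]
    obtain ⟨H, hH0, hH⟩ := exists_abs_le_of_periodic hper (h1.continuous_deriv le_rfl)
    refine ⟨H, 1, hH0, one_pos, fun x y => ?_⟩
    rw [Real.rpow_one]
    exact convex_univ.norm_image_sub_le_of_norm_deriv_le
      (fun z _ => (h1.differentiable one_ne_zero) z) (fun z _ => hH z) (Set.mem_univ y)
      (Set.mem_univ x)
  unfold IsClass at h
  split_ifs at h with htop
  · exact htwo (by exact_mod_cast contDiff_infty.1 h 2)
  obtain ⟨hcd, hhol⟩ := h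
  obtain h1 | h2 := (one_le_intPart hα htop).eq_or_lt
  · obtain ⟨C, hC⟩ := hhol
    rw [← h1, iteratedDeriv_one] at hC
    have hpos : 0 < fracPart α := by
      have h1' : 1 < α.toNNReal := by
        rw [← ENNReal.coe_lt_coe, ENNReal.coe_toNNReal htop]; exact_mod_cast hα
      rw [fracPart, ← h1]
      exact tsub_pos_of_lt (by simpa using h1')
    exact ⟨C, fracPart α, C.2, hpos, fun x y => hC.dist_le x y⟩
  · exact htwo (hcd.of_le (by exact_mod_cast h2))

theorem exists_sub_eq_deriv_mul_sub {F : ℝ → ℝ} (hF : Differentiable ℝ F) (X Y : ℝ) :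
    ∃ ξ ∈ Set.uIcc X Y, F X - F Y = deriv F ξ * (X - Y) := by
  rcases lt_trichotomy X Y with h | rfl | h
  · obtain ⟨ξ, hξ, h1⟩ := exists_deriv_eq_slope F h hF.continuous.continuousOn
      hF.differentiableOn
    refine ⟨ξ, Set.uIcc_of_lt h ▸ Set.Ioo_subset_Icc_self hξ, ?_⟩
    rw [h1]
    field_simp [sub_ne_zero.2 h.ne']
    ring
  · exact ⟨X, by simp, by simp⟩
  · obtain ⟨ξ, hξ, h1⟩ := exists_deriv_eq_slope F h hF.continuous.continuousOn
      hF.differentiableOn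
    refine ⟨ξ, Set.uIcc_of_gt h ▸ Set.Ioo_subset_Icc_self hξ, ?_⟩
    rw [h1, div_mul_cancel₀ _ (sub_ne_zero.2 h.ne')]

theorem abs_sub_le_of_abs_deriv_le {F : ℝ → ℝ} (hF : Differentiable ℝ F) {M : ℝ}
    (hM : ∀ x, |deriv F x| ≤ M) (X Y : ℝ) : |F X - F Y| ≤ M * |X - Y| := by
  obtain ⟨ξ, -, h⟩ := exists_sub_eq_deriv_mul_sub hF X Y
  rw [h, abs_mul]
  gcongr
  exact hM ξ

/-- Maps of the class `E ^ α` are Lipschitz. -/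
theorem IsExpandingMarkov.exists_lipschitz {α : ℝ≥0∞} (hα : 1 < α) {f : Circ → Circ}
    (hf : IsExpandingMarkov α f) :
    ∃ M : ℝ, 0 ≤ M ∧ ∀ x y, dist (f x) (f y) ≤ M * dist x y := by
  obtain ⟨F, hF, hcl, -⟩ := hf.smooth_expanding
  have hcd := hcl.contDiff_one hα
  obtain ⟨M, hM0, hM⟩ := exists_abs_le_of_periodic hF.periodic_deriv
    (hcd.continuous_deriv le_rfl)
  refine ⟨M, hM0, fun x y => ?_⟩
  obtain ⟨Y, rfl⟩ := QuotientAddGroup.mk_surjective y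
  obtain ⟨X, rfl, hX⟩ := exists_coe_eq_abs_sub_eq_dist x Y
  change dist (f (X : Circ)) (f (Y : Circ)) ≤ M * dist (X : Circ) (Y : Circ)
  rw [← hX, ← hF.2, ← hF.2]
  exact (dist_coe_le _ _).trans
    (abs_sub_le_of_abs_deriv_le (hcd.differentiable one_ne_zero) hM X Y)

/-- On small sets a circle map of class `C ^ α` with `1 < α` stretches all distances by nearly the
same factor, by the mean value theorem and the Hölder continuity of the derivative. -/
theorem IsExpandingMarkov.exists_isQuasiConformalExpanding {α : ℝ≥0∞} (hα : 1 < α)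
    {f : Circ → Circ} (hf : IsExpandingMarkov α f) :
    ∃ δ γ H β : ℝ, IsQuasiConformalExpanding f δ γ H β := by
  obtain ⟨F, hF, hcl, γ, hγ, hexp⟩ := hf.smooth_expanding
  have hcd := hcl.contDiff_one hα
  have hdiff := hcd.differentiable one_ne_zero
  obtain ⟨M, hM0, hM⟩ := exists_abs_le_of_periodic hF.periodic_deriv
    (hcd.continuous_deriv le_rfl)
  obtain ⟨H, β, hH, hβ, hhol⟩ := hcl.exists_holder_deriv hα hF
  have hM1 : 1 < M := hγ.trans ((hexp 0).trans_le (hM 0))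
  -- distances up to `2 * δ` on the circle and their images are distances of lifts
  set δ : ℝ := 1 / (4 * M) with hδ
  have hδM : M * (2 * δ) = 1 / 2 := by rw [hδ]; field_simp; norm_num
  have hδ0 : 0 < δ := by positivity
  have hfd : ∀ X Y : ℝ, |X - Y| ≤ 2 * δ →
      dist (X : Circ) (Y : Circ) = |X - Y| ∧ ∃ ξ ∈ Set.uIcc X Y,
        dist (f (X : Circ)) (f (Y : Circ)) = |deriv F ξ| * |X - Y| := by
    intro X Y hXY
    have h1 : M * |X - Y| ≤ 1 / 2 := by rw [← hδM]; gcongr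
    have h2 : |X - Y| ≤ 1 / 2 := by nlinarith [abs_nonneg (X - Y)]
    obtain ⟨ξ, hξ, h⟩ := exists_sub_eq_deriv_mul_sub hdiff X Y
    refine ⟨dist_coe_eq h2, ξ, hξ, ?_⟩
    rw [← hF.2, ← hF.2, dist_coe_eq
      ((abs_sub_le_of_abs_deriv_le hdiff hM X Y).trans h1), h, abs_mul]
  refine ⟨δ, γ, H * 2 ^ β, β, hδ0, hγ, by positivity, hβ, ?_, ?_⟩
  · intro x y hxy
    obtain ⟨Y, rfl⟩ := QuotientAddGroup.mk_surjective y
    obtain ⟨X, rfl, hX⟩ := exists_coe_eq_abs_sub_eq_dist x Y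
    obtain ⟨h1, ξ, -, h2⟩ := hfd X Y (by
      rw [hX]; exact hxy.trans (by linarith))
    change γ * dist (X : Circ) (Y : Circ) ≤ dist (f (X : Circ)) (f (Y : Circ))
    rw [h1, h2]
    gcongr
    exact (hexp ξ).le
  · intro S ρ hρ0 hρδ hS x hx y hy x' hx' y' hy'
    obtain ⟨Z, rfl⟩ := QuotientAddGroup.mk_surjective x
    have hlift : ∀ w ∈ S, ∃ W : ℝ, (W : Circ) = w ∧ W ∈ Set.Icc (Z - ρ) (Z + ρ) := by
      intro w hw
      obtain ⟨W, h1, h2⟩ := exists_coe_eq_abs_sub_eq_dist w Z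
      have h3 := h2.trans_le (hS _ hw _ hx)
      rw [abs_le] at h3
      exact ⟨W, h1, by constructor <;> linarith⟩
    have hpair : ∀ x ∈ S, ∀ y ∈ S, ∃ ξ ∈ Set.Icc (Z - ρ) (Z + ρ),
        dist (f x) (f y) = |deriv F ξ| * dist x y := by
      intro x hx y hy
      obtain ⟨X, rfl, hX⟩ := hlift x hx
      obtain ⟨Y, rfl, hY⟩ := hlift y hy
      obtain ⟨h1, ξ, hξ, h2⟩ := hfd X Y (by
        rw [abs_le]; constructor <;> linarith [hX.1, hX.2, hY.1, hY.2])
      exact ⟨ξ, Set.uIcc_subset_Icc hX hY hξ, by rw [h1, h2]⟩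
    obtain ⟨ξ, hξ, h1⟩ := hpair _ hx _ hy
    obtain ⟨ξ', hξ', h2⟩ := hpair _ hx' _ hy'
    rw [h1, h2]
    have h3 : |deriv F ξ'| ≤ (1 + H * 2 ^ β * ρ ^ β) * |deriv F ξ| := by
      have h4 : |ξ' - ξ| ≤ 2 * ρ := by
        rw [abs_le]; constructor <;> linarith [hξ.1, hξ.2, hξ'.1, hξ'.2]
      have h5 : |deriv F ξ' - deriv F ξ| ≤ H * 2 ^ β * ρ ^ β := by
        calc |deriv F ξ' - deriv F ξ| ≤ H * |ξ' - ξ| ^ β := hhol _ _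
          _ ≤ H * (2 * ρ) ^ β := by gcongr
          _ = H * 2 ^ β * ρ ^ β := by rw [Real.mul_rpow two_pos.le hρ0]; ring
      have h6 := abs_sub_abs_le_abs_sub (deriv F ξ') (deriv F ξ)
      have h7 : 1 ≤ |deriv F ξ| := (hγ.trans (hexp ξ)).le
      have h8 : 0 ≤ H * 2 ^ β * ρ ^ β := by positivity
      nlinarith
    calc |deriv F ξ'| * dist x' y' * dist (Z : Circ) y
        ≤ (1 + H * 2 ^ β * ρ ^ β) * |deriv F ξ| * dist x' y' * dist (Z : Circ) y := by gcongr
      _ = _ := by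
        change _ = (1 + H * 2 ^ β * ρ ^ β) * (dist x' y' * (|deriv F ξ| * dist (Z : Circ) y))
        ring

/-! ### The boundary of a Markov partition -/

/-- An open continuous map that is injective on an open set does not map boundary points of that
set into its image. -/
theorem notMem_image_of_mem_closure {X Y : Type*} [TopologicalSpace X] [T2Space X]
    [TopologicalSpace Y] {f : X → Y} (hc : Continuous f) (ho : IsOpenMap f) {O : Set X}
    (hO : IsOpen O) (hinj : Set.InjOn f O) {x : X} (hx : x ∈ closure O) (hxO : x ∉ O) :
    f x ∉ f '' O := by
  rintro ⟨y, hyO, hyx⟩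
  obtain ⟨U, V, hU, hV, hxU, hyV, hUV⟩ := t2_separation (show x ≠ y by rintro rfl; exact hxO hyO)
  have hfV : IsOpen (f '' (V ∩ O)) := ho _ (hV.inter hO)
  have hmem : U ∩ f ⁻¹' (f '' (V ∩ O)) ∈ 𝓝 x :=
    (hU.inter (hfV.preimage hc)).mem_nhds ⟨hxU, y, ⟨hyV, hyO⟩, hyx⟩
  obtain ⟨z, ⟨hzU, v, ⟨hvV, hvO⟩, hvz⟩, hzO⟩ := mem_closure_iff_nhds.1 hx _ hmem
  obtain rfl := hinj hvO hzO hvz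
  exact Set.disjoint_left.1 hUV hzU hvV

theorem isOpen_coe_image_Ioo (a b : ℝ) : IsOpen ((fun t : ℝ => (t : Circ)) '' Set.Ioo a b) :=
  QuotientAddGroup.isOpenMap_coe _ isOpen_Ioo

theorem coe_image_Icc_subset_closure_interior {a b : ℝ} (hab : a < b) :
    (fun t : ℝ => (t : Circ)) '' Set.Icc a b ⊆
      closure (interior ((fun t : ℝ => (t : Circ)) '' Set.Icc a b)) := by
  have hc : Continuous (fun t : ℝ => (t : Circ)) := AddCircle.continuous_mk' 1
  calc (fun t : ℝ => (t : Circ)) '' Set.Icc a b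
      = (fun t : ℝ => (t : Circ)) '' closure (Set.Ioo a b) := by rw [closure_Ioo hab.ne]
    _ ⊆ closure ((fun t : ℝ => (t : Circ)) '' Set.Ioo a b) := image_closure_subset_closure_image hc
    _ ⊆ _ := closure_mono (interior_maximal (Set.image_mono Set.Ioo_subset_Icc_self)
        (isOpen_coe_image_Ioo a b))

theorem coe_image_Icc_diff_interior_subset (a b : ℝ) :
    (fun t : ℝ => (t : Circ)) '' Set.Icc a b \
      interior ((fun t : ℝ => (t : Circ)) '' Set.Icc a b) ⊆ {(a : Circ), (b : Circ)} := by
  rintro _ ⟨⟨t, ht, rfl⟩, hnot⟩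
  by_contra hcon
  simp only [Set.mem_insert_iff, Set.mem_singleton_iff, not_or] at hcon
  refine hnot (interior_maximal (Set.image_mono Set.Ioo_subset_Icc_self)
        (isOpen_coe_image_Ioo a b) ⟨t, ⟨ht.1.lt_of_ne ?_, ht.2.lt_of_ne ?_⟩, rfl⟩)
  · rintro rfl; exact hcon.1 rfl
  · rintro rfl; exact hcon.2 rfl

/-- The points just outside the ends of an arc shorter than the circle are not in the arc. -/
theorem coe_notMem_coe_image_Icc {a b t : ℝ} (h1 : b - 1 < t) (h2 : t < a) :
    (t : Circ) ∉ (fun t : ℝ => (t : Circ)) '' Set.Icc a b := by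
  rintro ⟨u, hu, hut⟩
  obtain ⟨n, hn⟩ := AddCircle.coe_eq_zero_iff (1 : ℝ) |>.1
    (show ((u - t : ℝ) : Circ) = 0 by rw [AddCircle.coe_sub]; exact sub_eq_zero.2 hut)
  have hn' : (n : ℝ) = u - t := by simpa using hn
  have h3 : (0 : ℝ) < n := by linarith [hu.1]
  have h4 : (n : ℝ) < 1 := by linarith [hu.2]
  norm_cast at h3 h4
  omega

theorem coe_left_notMem_interior {a b : ℝ} (hba : b < a + 1) :
    (a : Circ) ∉ interior ((fun t : ℝ => (t : Circ)) '' Set.Icc a b) := by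
  intro h
  have hc : Continuous (fun t : ℝ => (t : Circ)) := AddCircle.continuous_mk' 1
  have h1 : (fun t : ℝ => (t : Circ)) ⁻¹'
      interior ((fun t : ℝ => (t : Circ)) '' Set.Icc a b) ∈ 𝓝 a :=
    (isOpen_interior.preimage hc).mem_nhds h
  obtain ⟨t, ht, hta⟩ := Filter.nonempty_of_mem (Filter.inter_mem
    (mem_nhdsWithin_of_mem_nhds h1)
    (Ioo_mem_nhdsLT (show b - 1 < a by linarith)))
  exact coe_notMem_coe_image_Icc hta.1 hta.2 (interior_subset ht)

theorem coe_right_notMem_interior {a b : ℝ} (hba : b < a + 1) :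
    (b : Circ) ∉ interior ((fun t : ℝ => (t : Circ)) '' Set.Icc a b) := by
  intro h
  have hc : Continuous (fun t : ℝ => (t : Circ)) := AddCircle.continuous_mk' 1
  have h1 : (fun t : ℝ => (t : Circ)) ⁻¹'
      interior ((fun t : ℝ => (t : Circ)) '' Set.Icc a b) ∈ 𝓝 b :=
    (isOpen_interior.preimage hc).mem_nhds h
  obtain ⟨t, ht, htb⟩ := Filter.nonempty_of_mem (Filter.inter_mem
    (mem_nhdsWithin_of_mem_nhds h1)
    (Ioo_mem_nhdsGT (show b < a + 1 by linarith)))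
  refine coe_notMem_coe_image_Icc (a := a) (b := b) (t := t - 1) (by linarith [htb.1])
    (by linarith [htb.2]) ?_
  have h2 : ((t - 1 : ℝ) : Circ) = (t : Circ) := by
    rw [AddCircle.coe_sub, AddCircle.coe_period, sub_zero]
  rw [h2]
  exact interior_subset ht

/-- The endpoints of the arcs of a Markov partition. -/
def partitionBoundary {d : ℕ} (P : Fin d → Set Circ) : Set Circ :=
  ⋃ i, P i \ interior (P i)

namespace IsMarkovPartition

variable {φ : Circ → Circ} {d : ℕ} {P : Fin d → Set Circ}

theorem finite_partitionBoundary (hP : IsMarkovPartition φ P) : (partitionBoundary P).Finite := by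
  refine Set.finite_iUnion fun i => ?_
  obtain ⟨a, b, -, -, h⟩ := hP.arc i
  rw [h]
  exact (Set.toFinite _).subset (coe_image_Icc_diff_interior_subset a b)

/-- If `φ` sent an endpoint of `P i` into the interior of `P j`, then the image of the interior of
`P i` would meet that interior, and so contain it by the Markov property; but the image of the
endpoint is not in the image of the interior, because `φ` is open and injective there. -/
theorem mapsTo_partitionBoundary (hP : IsMarkovPartition φ P) (hφ : IsLocalHomeomorph φ) :
    Set.MapsTo φ (partitionBoundary P) (partitionBoundary P) := by
  intro x hx
  obtain ⟨i, hxi, hxi'⟩ := Set.mem_iUnion.1 hx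
  obtain ⟨j, hj⟩ := Set.mem_iUnion.1 (hP.cover.symm ▸ Set.mem_univ (φ x))
  refine Set.mem_iUnion.2 ⟨j, hj, fun hj' => ?_⟩
  have hcl : x ∈ closure (interior (P i)) := by
    obtain ⟨a, b, hab, -, h⟩ := hP.arc i
    rw [h] at hxi ⊢
    exact coe_image_Icc_subset_closure_interior hab hxi
  obtain ⟨z, hz, hzi⟩ := mem_closure_iff_nhds.1 hcl _
    ((isOpen_interior.preimage hφ.continuous).mem_nhds hj')
  exact notMem_image_of_mem_closure hφ.continuous hφ.isOpenMap isOpen_interior (hP.injOn i) hcl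
    hxi' (hP.markov i j ⟨φ z, ⟨z, hzi, rfl⟩, hz⟩ hj')

end IsMarkovPartition

/-! ### Countability of the subshifts of finite type -/

/-- An expanding map has countably many preperiodic points. -/
theorem IsQuasiConformalExpanding.countable_preperiodic {X : Type*} [MetricSpace X]
    [SecondCountableTopology X] {φ : X → X} {δ γ H β : ℝ}
    (h : IsQuasiConformalExpanding φ δ γ H β) (hφ : Continuous φ) :
    {x | ∃ m n : ℕ, m < n ∧ φ^[m] x = φ^[n] x}.Countable := by
  have key : ∀ m n : ℕ, m < n → {x | φ^[m] x = φ^[n] x}.Countable := by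
    intro m n hmn
    set S := {x | φ^[m] x = φ^[n] x} with hS
    -- two such points are equal if they stay `δ`-close up to time `n`
    set U : X → Set X := fun x => ⋂ i ∈ Set.Iic n, {y | dist (φ^[i] x) (φ^[i] y) < δ} with hU
    have hUx : ∀ x ∈ S, U x ∈ 𝓝[S] x := by
      intro x _
      refine mem_nhdsWithin_of_mem_nhds ((Filter.biInter_mem (Set.finite_Iic n)).2 fun i _ => ?_)
      exact (isOpen_lt (continuous_const.dist (hφ.iterate i)) continuous_const).mem_nhds
        (by simpa using h.delta_pos)
    obtain ⟨t, htS, ht, hcov⟩ := TopologicalSpace.countable_cover_nhdsWithin hUx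
    refine ht.mono fun y hy => ?_
    obtain ⟨x, hx, hyx⟩ := Set.mem_iUnion₂.1 (hcov hy)
    have hclose : ∀ i ≤ n, dist (φ^[i] x) (φ^[i] y) ≤ δ := fun i hi =>
      (Set.mem_iInter₂.1 hyx i hi).le
    have hxy : φ^[m] x = φ^[m] y := by
      by_contra hne
      have h1 := h.pow_mul_dist_le (x := φ^[m] x) (y := φ^[m] y) (m := n - m) fun j hj => by
        rw [← Function.iterate_add_apply, ← Function.iterate_add_apply]
        exact hclose _ (by omega)
      rw [← Function.iterate_add_apply, ← Function.iterate_add_apply, Nat.sub_add_cancel hmn.le,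
        ← htS hx, ← hy] at h1
      have h2 : 0 < dist (φ^[m] x) (φ^[m] y) := dist_pos.2 hne
      have h3 : 1 < γ ^ (n - m) := one_lt_pow₀ h.one_lt_gamma (by omega)
      nlinarith
    have hxy' : x = y := by
      by_contra hne
      have h1 := h.dist_iterate_pos (m := m) (fun j hj => hclose j (by omega)) hne
      rw [hxy, dist_self] at h1
      exact lt_irrefl _ h1
    exact hxy' ▸ hx
  have : {x | ∃ m n : ℕ, m < n ∧ φ^[m] x = φ^[n] x} =
      ⋃ (m : ℕ) (n : ℕ) (_ : m < n), {x | φ^[m] x = φ^[n] x} := by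
    ext x; simp
  rw [this]
  exact Set.countable_iUnion fun m => Set.countable_iUnion fun n => Set.countable_iUnion fun hmn =>
    key m n hmn

theorem exists_iterate_eq_of_mapsTo_finite {X : Type*} {φ : X → X} {E : Set X} (hE : E.Finite)
    (hφ : Set.MapsTo φ E E) {x : X} (hx : x ∈ E) : ∃ m n : ℕ, m < n ∧ φ^[m] x = φ^[n] x := by
  obtain ⟨m, -, n, -, hmn, h⟩ := Set.infinite_univ.exists_ne_map_eq_of_mapsTo
    (f := fun n : ℕ => φ^[n] x) (fun n _ => hφ.iterate n hx) hE
  rcases hmn.lt_or_gt with h' | h'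
  · exact ⟨m, n, h', h⟩
  · exact ⟨n, m, h', h.symm⟩

theorem countable_preimage_coe {Q : Set Circ} (hQ : Q.Countable) :
    ((fun t : ℝ => (t : Circ)) ⁻¹' Q).Countable := by
  rw [← Set.biUnion_preimage_singleton]
  refine hQ.biUnion fun q _ => ?_
  obtain ⟨x, rfl⟩ := QuotientAddGroup.mk_surjective q
  refine (Set.countable_range fun n : ℤ => x + n).mono fun y hy => ?_
  obtain ⟨n, hn⟩ := AddCircle.coe_eq_zero_iff (1 : ℝ) |>.1
    (show ((y - x : ℝ) : Circ) = 0 by rw [AddCircle.coe_sub]; exact sub_eq_zero.2 hy)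
  have hn' : (n : ℝ) = y - x := by simpa using hn
  exact ⟨n, by simp [hn']⟩

/-- An expanding circle map has countably many subshifts of finite type, because the endpoints of
the arcs of its Markov partitions are preperiodic. -/
theorem IsExpandingMarkov.countable_setOf_isSFT {α : ℝ≥0∞} (hα : 1 < α) {φ : Circ → Circ}
    (hφ : IsExpandingMarkov α φ) : {K | IsSFT φ K}.Countable := by
  obtain ⟨δ, γ, H, β, hexp⟩ := hφ.exists_isQuasiConformalExpanding hα
  have hB := countable_preimage_coe
    (hexp.countable_preperiodic hφ.isLocalHomeomorph.continuous)
  set B : Set ℝ := (fun t : ℝ => (t : Circ)) ⁻¹' {x | ∃ m n : ℕ, m < n ∧ φ^[m] x = φ^[n] x}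
  set arcs : Set (Set Circ) :=
    (fun p : ℝ × ℝ => (fun t : ℝ => (t : Circ)) '' Set.Icc p.1 p.2) '' (B ×ˢ B) with harcs
  have harcs_count : arcs.Countable := (hB.prod hB).image _
  have hmem : ∀ (d : ℕ) (P : Fin d → Set Circ), IsMarkovPartition φ P → ∀ i, P i ∈ arcs := by
    intro d P hP i
    have hE : ∀ x ∈ partitionBoundary P, ∃ m n : ℕ, m < n ∧ φ^[m] x = φ^[n] x := fun x hx =>
      exists_iterate_eq_of_mapsTo_finite hP.finite_partitionBoundary
        (hP.mapsTo_partitionBoundary hφ.isLocalHomeomorph) hx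
    obtain ⟨a, b, hab, hba, h⟩ := hP.arc i
    refine ⟨(a, b), ⟨hE _ (Set.mem_iUnion.2 ⟨i, ?_, ?_⟩), hE _ (Set.mem_iUnion.2 ⟨i, ?_, ?_⟩)⟩,
      h.symm⟩ <;> simp only [h]
    · exact ⟨a, ⟨le_rfl, hab.le⟩, rfl⟩
    · exact coe_left_notMem_interior hba
    · exact ⟨b, ⟨hab.le, le_rfl⟩, rfl⟩
    · exact coe_right_notMem_interior hba
  have hsub : {K | IsSFT φ K} ⊆ ⋃ d : ℕ, (fun q : (Fin d → Set Circ) × Finset (List (Fin d)) =>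
      {x | ∃ s ∈ subshiftOfFiniteType q.2, Codes φ q.1 s x}) ''
        ({P | ∀ i, P i ∈ arcs} ×ˢ Set.univ) := by
    rintro K ⟨d, P, W, hP, rfl⟩
    exact Set.mem_iUnion.2 ⟨d, (P, W), ⟨hmem d P hP, Set.mem_univ _⟩, rfl⟩
  refine (Set.countable_iUnion fun d => Set.Countable.image ?_ _).mono hsub
  exact (Set.countable_pi fun _ => harcs_count).prod Set.countable_univ

/-! ### Subshifts of finite type are compact and forward invariant -/

theorem isClosed_subshiftOfFiniteType {d : ℕ} (W : Finset (List (Fin d))) :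
    IsClosed (subshiftOfFiniteType W) := by
  have : subshiftOfFiniteType W = ⋂ w ∈ W, ⋂ n : ℕ,
      (fun (s : ℕ → Fin d) (i : Fin w.length) => s (n + i)) ⁻¹'
        {u | List.ofFn u ≠ w} := by
    ext s; simp [subshiftOfFiniteType]
  rw [this]
  refine isClosed_biInter fun w _ => isClosed_iInter fun n => ?_
  exact (isClosed_discrete _).preimage (by fun_prop)

/-- Being in the closed cylinder of the first `n` symbols is a closed condition, since there are
finitely many words of length `n`. -/
theorem isClosed_setOf_codes (φ : Circ → Circ) {d : ℕ} (P : Fin d → Set Circ) :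
    IsClosed {p : (ℕ → Fin d) × Circ | Codes φ P p.1 p.2} := by
  have : {p : (ℕ → Fin d) × Circ | Codes φ P p.1 p.2} =
      ⋂ n : ℕ, (fun p : (ℕ → Fin d) × Circ => ((fun i : Fin n => p.1 i), p.2)) ⁻¹'
        {q | q.2 ∈ closure (⋂ j : Fin n, φ^[j] ⁻¹' interior (P (q.1 j)))} := by
    ext p
    simp only [Codes, Set.mem_ofPred_eq, Set.mem_iInter, Set.mem_preimage]
    refine forall_congr' fun n => ?_
    have : (⋂ j ∈ Set.Iio n, φ^[j] ⁻¹' interior (P (p.1 j))) =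
        ⋂ j : Fin n, φ^[j] ⁻¹' interior (P (p.1 j)) := by
      ext x
      simp only [Set.mem_iInter, Set.mem_Iio]
      exact ⟨fun h j => h j j.2, fun h j hj => h ⟨j, hj⟩⟩
    rw [this]
  rw [this]
  refine isClosed_iInter fun n => IsClosed.preimage (by fun_prop) ?_
  have : {q : (Fin n → Fin d) × Circ |
      q.2 ∈ closure (⋂ j : Fin n, φ^[j] ⁻¹' interior (P (q.1 j)))} =
      ⋃ u : Fin n → Fin d, {u} ×ˢ closure (⋂ j : Fin n, φ^[j] ⁻¹' interior (P (u j))) := by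
    ext ⟨u, x⟩; simp
  rw [this]
  exact isClosed_iUnion_of_finite fun u => isClosed_singleton.prod isClosed_closure

theorem IsSFT.isCompact {φ : Circ → Circ} {K : Set Circ} (hK : IsSFT φ K) : IsCompact K := by
  obtain ⟨d, P, W, -, rfl⟩ := hK
  have h : IsCompact ({p : (ℕ → Fin d) × Circ | Codes φ P p.1 p.2} ∩
      Prod.fst ⁻¹' subshiftOfFiniteType W) :=
    ((isClosed_setOf_codes φ P).inter
      ((isClosed_subshiftOfFiniteType W).preimage continuous_fst)).isCompact
  have h2 : {x | ∃ s ∈ subshiftOfFiniteType W, Codes φ P s x} =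
      Prod.snd '' ({p : (ℕ → Fin d) × Circ | Codes φ P p.1 p.2} ∩
      Prod.fst ⁻¹' subshiftOfFiniteType W) := by
    ext x
    constructor
    · rintro ⟨s, hs, hx⟩
      exact ⟨(s, x), ⟨hx, hs⟩, rfl⟩
    · rintro ⟨⟨s, y⟩, ⟨hx, hs⟩, rfl⟩
      exact ⟨s, hs, hx⟩
  rw [h2]
  exact h.image continuous_snd

/-- The map `φ` acts on codes as the shift. -/
theorem IsSFT.mapsTo {φ : Circ → Circ} (hφ : Continuous φ) {K : Set Circ} (hK : IsSFT φ K) :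
    Set.MapsTo φ K K := by
  obtain ⟨d, P, W, -, rfl⟩ := hK
  rintro x ⟨s, hs, hx⟩
  refine ⟨fun n => s (n + 1), fun w hw n => ?_, fun n => ?_⟩
  · have h1 := hs w hw (n + 1)
    simp only [add_right_comm n 1] at h1
    exact h1
  · refine closure_mono ?_ (image_closure_subset_closure_image hφ ⟨x, hx (n + 1), rfl⟩)
    rintro _ ⟨y, hy, rfl⟩
    refine Set.mem_iInter₂.2 fun j hj => ?_
    have h1 := Set.mem_iInter₂.1 hy (j + 1) (Set.mem_Iio.2 (Nat.succ_lt_succ hj))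
    rwa [Set.mem_preimage, Function.iterate_succ_apply] at h1

/-! ### Rotations and the `C ^ α` topology -/

theorem IsLift.add_coe {F : ℝ → ℝ} {f : Circ → Circ} (hF : IsLift F f) (c : ℝ) :
    IsLift (fun x => F x + c) fun x => f x + (c : Circ) :=
  ⟨hF.1.add_const c, fun x => by rw [AddCircle.coe_add, hF.2]⟩

theorem iteratedDeriv_add_const {F : ℝ → ℝ} (c : ℝ) {j : ℕ} (hj : 1 ≤ j) :
    iteratedDeriv j (fun x => F x + c) = iteratedDeriv j F := by
  obtain ⟨j, rfl⟩ : ∃ i, j = i + 1 := ⟨j - 1, by omega⟩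
  rw [iteratedDeriv_succ', iteratedDeriv_succ']
  congr 1
  funext x
  simp

theorem IsClass.add_const {α : ℝ≥0∞} (hα : 1 < α) {F : ℝ → ℝ} (h : IsClass α F) (c : ℝ) :
    IsClass α fun x => F x + c := by
  unfold IsClass at h ⊢
  split_ifs at h ⊢ with htop
  · exact h.add contDiff_const
  · rw [iteratedDeriv_add_const c (one_le_intPart hα htop)]
    exact ⟨h.1.add contDiff_const, h.2⟩

theorem IsExpandingMarkov.add_const {α : ℝ≥0∞} (hα : 1 < α) {f : Circ → Circ}
    (hf : IsExpandingMarkov α f) (t : Circ) : IsExpandingMarkov α fun x => f x + t := by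
  refine ⟨(Homeomorph.addRight t).isLocalHomeomorph.comp hf.isLocalHomeomorph, ?_, ?_⟩
  · obtain ⟨F, hF, hcl, γ, hγ, hexp⟩ := hf.smooth_expanding
    obtain ⟨c, rfl⟩ := QuotientAddGroup.mk_surjective t
    exact ⟨fun x => F x + c, hF.add_coe c, hcl.add_const hα c, γ, hγ, by simpa using hexp⟩
  · obtain ⟨X, p, hX, hbij⟩ := hf.full_branches
    refine ⟨X, p + t, hX, fun x hx =>
      Set.BijOn.comp (g := fun y => y + t) (t := {p}ᶜ) ?_ (hbij x hx)⟩
    refine ⟨fun y hy h => hy (add_right_cancel h), (add_left_injective t).injOn, fun y hy => ?_⟩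
    exact ⟨y - t, fun h => hy (by rw [← show y - t = p from h]; simp), by simp⟩

/-- The expanding Markov map `f` followed by the rotation by `t`. -/
def ExpandingMarkovMap.rotate {α : ℝ≥0∞} (hα : 1 < α) (f : ExpandingMarkovMap α) (t : Circ) :
    ExpandingMarkovMap α :=
  ⟨fun x => f x + t, f.isExpandingMarkov.add_const hα t⟩

/-- Rotating a map only moves its values: neither its derivatives nor the difference of two lifts,
which is constant, contribute to the distance. -/
theorem classEDist_add_const_le {F : ℝ → ℝ} {f : Circ → Circ} (hF : IsLift F f) (k : ℕ) (β : ℝ≥0)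
    (t : Circ) : classEDist k β (fun x => f x + t) f ≤ edist t 0 := by
  obtain ⟨c, rfl⟩ := QuotientAddGroup.mk_surjective t
  have hG : IsLift (fun x => F x + c) fun x => f x + (c : Circ) := hF.add_coe c
  have hderiv : ∀ j, 1 ≤ j →
      circleDeriv j (fun x => f x + (c : Circ)) = circleDeriv j f := by
    intro j hj
    rw [circleDeriv_eq hG hj, circleDeriv_eq hF hj, iteratedDeriv_add_const c hj]
  have hconst : ∃ b : ℝ, circleDeriv k (fun x => f x + (c : Circ)) - circleDeriv k f =
      Function.const ℝ b := by
    rcases Nat.eq_zero_or_pos k with rfl | hk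
    · have hex : ∀ {G : ℝ → ℝ} {g : Circ → Circ}, IsLift G g → IsLift (lift g) g := by
        intro G g h
        unfold lift
        have hG : ∃ G, IsLift G g := ⟨G, h⟩
        rw [dif_pos hG]
        exact hG.choose_spec
      obtain ⟨b, hb⟩ := (hex hG).sub_const ((hex hF).add_coe c)
      refine ⟨c + b, funext fun x => ?_⟩
      simp only [circleDeriv, iteratedDeriv_zero, Pi.sub_apply, hb, Function.const_apply]
      ring
    · exact ⟨0, by rw [hderiv k hk, sub_self]; rfl⟩
  obtain ⟨b, hb⟩ := hconst
  have hsum : (∑ j ∈ Finset.Icc 1 k, ⨆ x : ℝ,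
      edist (circleDeriv j (fun x => f x + (c : Circ)) x) (circleDeriv j f x)) = 0 :=
    Finset.sum_eq_zero fun j hj => by simp [hderiv j (Finset.mem_Icc.1 hj).1]
  change classEDist k β (fun x => f x + (c : Circ)) f ≤ edist (c : Circ) 0
  unfold classEDist
  rw [hb, hsum, eHolderNorm_const, add_zero, add_zero]
  refine iSup_le fun x => le_of_eq ?_
  simpa using edist_add_left (f x) (c : Circ) 0

theorem nhds_classTopology (α : ℝ≥0∞) (f : Circ → Circ) :
    @nhds _ (classTopology α) f =
      if α = ⊤ then ⨅ k : ℕ, @nhds _ (classPseudoEMetric k 0).toUniformSpace.toTopologicalSpace f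
      else @nhds _ (classPseudoEMetric (intPart α)
        (fracPart α)).toUniformSpace.toTopologicalSpace f := by
  by_cases htop : α = ⊤
  · have h : classTopology α =
        ⨅ k : ℕ, (classPseudoEMetric k 0).toUniformSpace.toTopologicalSpace := if_pos htop
    rw [if_pos htop, h]
    exact @nhds_iInf _ _ _ f
  · have h : classTopology α =
        (classPseudoEMetric (intPart α) (fracPart α)).toUniformSpace.toTopologicalSpace :=
      if_neg htop
    rw [if_neg htop, h]

theorem ExpandingMarkovMap.tendsto_rotate {α : ℝ≥0∞} (hα : 1 < α) (f : ExpandingMarkovMap α) :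
    Filter.Tendsto (f.rotate hα) (𝓝 0) (𝓝 f) := by
  obtain ⟨F, hF, -⟩ := f.isExpandingMarkov.smooth_expanding
  have key : ∀ (k : ℕ) (β : ℝ≥0), Filter.Tendsto (fun t : Circ => fun x => f x + t) (𝓝 0)
      (@nhds _ (classPseudoEMetric k β).toUniformSpace.toTopologicalSpace f) := by
    intro k β
    refine (@EMetric.tendsto_nhds _ _ (classPseudoEMetric k β) _ _ _).2 fun ε hε => ?_
    filter_upwards [Metric.eball_mem_nhds (0 : Circ) hε] with t ht
    exact (classEDist_add_const_le hF k β t).trans_lt ht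
  rw [@nhds_induced _ _ (classTopology α) ExpandingMarkovMap.toFun f, Filter.tendsto_comap_iff]
  change Filter.Tendsto (fun t : Circ => fun x => f x + t) _ _
  rw [nhds_classTopology]
  split_ifs with htop
  · exact Filter.tendsto_iInf.2 fun k => key k 0
  · exact key _ _

theorem setOf_iSup_edist_lt_mem_nhds (α : ℝ≥0∞) (f : Circ → Circ) {ε : ℝ≥0∞} (hε : 0 < ε) :
    {g : Circ → Circ | ∀ x, edist (g x) (f x) < ε} ∈ @nhds _ (classTopology α) f := by
  have key : ∀ (k : ℕ) (β : ℝ≥0), {g : Circ → Circ | ∀ x, edist (g x) (f x) < ε} ∈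
      @nhds _ (classPseudoEMetric k β).toUniformSpace.toTopologicalSpace f := by
    intro k β
    refine Filter.mem_of_superset
      (@Metric.eball_mem_nhds _ (classPseudoEMetric k β) f ε hε) fun g hg x => ?_
    have hg' : classEDist k β g f < ε := hg
    refine lt_of_le_of_lt ?_ hg'
    unfold classEDist
    exact (le_iSup (fun x => edist (g x) (f x)) x).trans (le_self_add.trans le_self_add)
  rw [nhds_classTopology]
  split_ifs with htop
  · exact Filter.mem_iInf_of_mem 0 (key 0 0)
  · exact key _ _

theorem isOpen_setOf_image_inter_eq_empty {α : ℝ≥0∞} {K : Set Circ} (hK : IsCompact K) :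
    IsOpen {f : ExpandingMarkovMap α | f '' K ∩ K = ∅} := by
  rw [isOpen_iff_mem_nhds]
  intro f hf
  obtain ⟨ε, hε, hdisj⟩ := (Set.disjoint_iff_inter_eq_empty.2 hf).exists_thickenings
    (hK.image f.isExpandingMarkov.isLocalHomeomorph.continuous) hK.isClosed
  rw [@nhds_induced _ _ (classTopology α) ExpandingMarkovMap.toFun f]
  refine Filter.mem_comap.2 ⟨_, setOf_iSup_edist_lt_mem_nhds α f (ENNReal.ofReal_pos.2 hε), ?_⟩
  intro g hg
  refine Set.disjoint_iff_inter_eq_empty.1 (Set.disjoint_left.2 ?_)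
  rintro _ ⟨x, hx, rfl⟩ hgx
  exact Set.disjoint_left.1 hdisj ((Metric.mem_thickening_iff_exists_edist_lt _ _).2
    ⟨f x, ⟨x, hx, rfl⟩, hg x⟩) (Metric.self_subset_thickening hε _ hgx)

/-! ### Generic maps -/

/-- Almost every rotation moves the image of a forward invariant compact set of dimension less than
`1 / 2` off that set. -/
theorem volume_setOf_rotate_eq_zero {α : ℝ≥0∞} (hα : 1 < α) (φ f : ExpandingMarkovMap α)
    {K : Set Circ} (hK : IsCompact K) (hφK : Set.MapsTo φ K K) (hdim : dimH K < 1 / 2) :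
    volume {t : Circ | ∃ x ∈ K, f x + t ∈ K} = 0 := by
  obtain ⟨s, hs1, hs2⟩ := ENNReal.lt_iff_exists_nnreal_btwn.1 hdim
  have hs0 : (0 : ℝ) < s := by
    have : (0 : ℝ≥0∞) < s := bot_le.trans_lt hs1
    exact_mod_cast this
  have hs2' : (s : ℝ) < 1 / 2 := by
    have : s < (1 / 2 : ℝ≥0) := by
      rw [← ENNReal.coe_lt_coe]; simpa using hs2
    exact_mod_cast this
  obtain ⟨δ, γ, H, β, hexp⟩ := φ.isExpandingMarkov.exists_isQuasiConformalExpanding hα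
  obtain ⟨A, hA, hcov⟩ := hexp.exists_card_cover_le hK hφK hs0 (by linarith)
    (hausdorffMeasure_of_dimH_lt hs1)
  obtain ⟨M, hM, hlip⟩ := f.isExpandingMarkov.exists_lipschitz hα
  exact volume_setOf_add_mem_eq_zero hs2' hA hcov hM hlip

end ExpandingCircle

end

theorem mainTheorem2 (α : ENNReal) (hα : 1 < α) (φ : ExpandingCircle.ExpandingMarkovMap α) :
    ∃ G : Set (ExpandingCircle.ExpandingMarkovMap α), IsGδ G ∧ Dense G ∧
      ∀ f ∈ G, ∀ K : Set UnitAddCircle, ExpandingCircle.IsSFT φ K → dimH K < 1 / 2 →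
        f '' K ∩ K = ∅ := by
  set 𝒦 : Set (Set UnitAddCircle) := {K | ExpandingCircle.IsSFT φ K ∧ dimH K < 1 / 2} with h𝒦
  have hcount : 𝒦.Countable :=
    (φ.isExpandingMarkov.countable_setOf_isSFT hα).mono fun K hK => hK.1
  have hcont : Continuous φ := φ.isExpandingMarkov.isLocalHomeomorph.continuous
  refine ⟨⋂ K ∈ 𝒦, {f | f '' K ∩ K = ∅}, ?_, ?_, ?_⟩
  · exact IsGδ.biInter_of_isOpen hcount fun K hK =>
      ExpandingCircle.isOpen_setOf_image_inter_eq_empty hK.1.isCompact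
  · intro f
    rw [mem_closure_iff_nhds]
    intro V hV
    -- the rotations that fail for one of the countably many `K` form a null set
    have hnull : MeasureTheory.volume (⋃ K ∈ 𝒦, {t : UnitAddCircle | ∃ x ∈ K, f x + t ∈ K}) = 0 :=
      (MeasureTheory.measure_biUnion_null_iff hcount).2 fun K hK =>
        ExpandingCircle.volume_setOf_rotate_eq_zero hα φ f hK.1.isCompact (hK.1.mapsTo hcont) hK.2
    have hpos : MeasureTheory.volume (f.rotate hα ⁻¹' V) ≠ 0 :=
      (MeasureTheory.Measure.measure_pos_of_mem_nhds _ (f.tendsto_rotate hα hV)).ne'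
    obtain ⟨t, htV, ht⟩ : ∃ t ∈ f.rotate hα ⁻¹' V,
        t ∉ ⋃ K ∈ 𝒦, {t : UnitAddCircle | ∃ x ∈ K, f x + t ∈ K} := by
      by_contra! hcon
      exact hpos (MeasureTheory.measure_mono_null hcon hnull)
    refine ⟨f.rotate hα t, htV, Set.mem_iInter₂.2 fun K hK => ?_⟩
    refine Set.disjoint_iff_inter_eq_empty.1 (Set.disjoint_left.2 ?_)
    rintro _ ⟨x, hx, rfl⟩ hxK
    exact ht (Set.mem_iUnion₂.2 ⟨K, hK, x, hx, hxK⟩)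
  · intro f hf K hK hdim
    exact Set.mem_iInter₂.1 hf K ⟨hK, hdim⟩
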